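/- Let $\mathcal{O}$ be a discrete valuation ring with field of fractions $F$ and uniformizer $\varpi$ (for instance, the ring of integers of a non-archimedean local field $F$). Let $V = W_1 \oplus W_2$ be an $F$-vector space with $\dim W_1 = n_1 \le n_2 = \dim W_2 < \infty$, and let $L = \mathrm{GL}(W_1)\times \mathrm{GL}(W_2) \subset \mathrm{GL}(V)$. The vertices of the Euclidean building $\mathcal{B}_e\mathrm{GL}(V)$ are the homothety classes $[\Lambda]=\{a\Lambda : a\in F^\times\}$ of $\mathcal{O}$-lattices $\Lambda\subset V$ (finitely generated $\mathcal{O}$-submodules spanning $V$ over $F$). Two distinct vertices are joined by an edge of the $1$-skeleton if and only if they have representatives with $\varpi\Lambda_1\subset\Lambda_2\subset\Lambda_1$. Let $A^{n_1}=\{\alpha\in\mathbb{N}^{n_1} : \alpha_i\ge\alpha_{i+1}\}$ (with $0\in\mathbb{N}$), choose bases $e_1,\dots,e_{n_1}$ of $W_1$ and $f_1,\dots,f_{n_2}$ of $W_2$, and for $\alpha\in A^{n_1}$ put $$\Lambda^\alpha=\bigoplus_{i=1}^{n_1}\left(\mathcal{O}e_i+\mathcal{O}(\varpi^{-\alpha_i}e_i+f_i)\right)\oplus\bigoplus_{j=n_1+1}^{n_2}\mathcal{O}f_j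 .$$ Then $\alpha\mapsto L[\Lambda^\alpha]$ is a bijection from $A^{n_1}$ onto the set of $L$-orbits of vertices of $\mathcal{B}_e\mathrm{GL}(V)$. Moreover, if $[\Lambda_1],[\Lambda_2]$ are vertices whose $L$-orbits correspond to $\alpha,\beta\in A^{n_1}$ under this bijection, then $$\min\{d(y_1,y_2) : y_1\in L[\Lambda_1],\ y_2\in L[\Lambda_2]\}=\max_{1\le i\le n_1}|\alpha_i-\beta_i| ,$$ where $d$ is the graph distance in the $1$-skeleton of $\mathcal{B}_e\mathrm{GL}(V)$ (and the right-hand side is $0$ if $n_1=0$). -/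

import Mathlib

open scoped Pointwise

namespace LeviBuilding

section Building

variable (O F V : Type*) [CommRing O] [Field F] [Algebra O F]
  [AddCommGroup V] [Module F V] [Module O V] [IsScalarTower O F V]

/-- The `O`-lattices in the `F`-vector space `V`: finitely generated `O`-submodules that span `V`
over `F`. (If `O` is a principal ideal domain, such a module is automatically free.) -/
def OLattice : Type _ := {Λ : Submodule O V // Submodule.IsLattice F Λ}

variable {O F V}

lemma isLattice_smul (g : V ≃ₗ[F] V) (Λ : Submodule O V) (h : Submodule.IsLattice F Λ) :
    Submodule.IsLattice F (g • Λ) where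
  fg := h.fg.map _
  span_eq_top := by
    rw [Submodule.coe_pointwise_smul]
    have : g • (Λ : Set V) = (g : V →ₗ[F] V) '' (Λ : Set V) := rfl
    rw [this, ← Submodule.map_span, h.span_eq_top, Submodule.map_top]
    exact LinearEquiv.range g

/-- Scalars `a ∈ Fˣ` act on lattices by `Λ ↦ a Λ`. -/
instance : MulAction Fˣ (OLattice O F V) where
  smul a Λ := ⟨a • Λ.1, haveI := Λ.2; inferInstance⟩
  one_smul Λ := Subtype.ext (one_smul _ Λ.1)
  mul_smul a b Λ := Subtype.ext (mul_smul a b Λ.1)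

/-- `GL(V)` acts on lattices by `Λ ↦ g(Λ)`. -/
instance : MulAction (V ≃ₗ[F] V) (OLattice O F V) where
  smul g Λ := ⟨g • Λ.1, isLattice_smul g Λ.1 Λ.2⟩
  one_smul Λ := Subtype.ext (one_smul _ Λ.1)
  mul_smul a b Λ := Subtype.ext (mul_smul a b Λ.1)

lemma smul_homothety_comm (g : V ≃ₗ[F] V) (a : Fˣ) (Λ : OLattice O F V) :
    g • a • Λ = a • g • Λ :=
  Subtype.ext <| SetLike.coe_injective <|
    (smul_comm g a (Λ.1 : Set V) : g • a • (Λ.1 : Set V) = a • g • (Λ.1 : Set V))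

variable (O F V) in
/-- The vertices of the Euclidean building of `GL(V)`: homothety classes
`[Λ] = {a Λ | a ∈ Fˣ}` of lattices. -/
def Vertex : Type _ := MulAction.orbitRel.Quotient Fˣ (OLattice O F V)

/-- The homothety class `[Λ]`. -/
def Vertex.mk (Λ : OLattice O F V) : Vertex O F V :=
  Quotient.mk (MulAction.orbitRel Fˣ (OLattice O F V)) Λ

/-- The action `g [Λ] = [g Λ]` of `GL(V)` on the vertices. -/
instance : MulAction (V ≃ₗ[F] V) (Vertex O F V) where
  smul g := Quotient.map (g • ·) (by
    rintro _ Λ ⟨a, rfl⟩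
    exact ⟨a, (smul_homothety_comm g a Λ).symm⟩)
  one_smul x := by
    induction x using Quotient.inductionOn with
    | h Λ => exact congrArg Vertex.mk (one_smul _ Λ)
  mul_smul g h x := by
    induction x using Quotient.inductionOn with
    | h Λ => exact congrArg Vertex.mk (mul_smul g h Λ)

/-- Two vertices are incident if they have representatives with `ϖ Λ₁ ⊆ Λ₂ ⊆ Λ₁`. -/
def Incident (ϖ : O) (x y : Vertex O F V) : Prop :=
  ∃ Λ₁ Λ₂ : OLattice O F V, Vertex.mk Λ₁ = x ∧ Vertex.mk Λ₂ = y ∧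
    ϖ • Λ₁.1 ≤ Λ₂.1 ∧ Λ₂.1 ≤ Λ₁.1

variable (F V) in
/-- The 1-skeleton of the building: distinct vertices are joined by an edge if and only if they are
incident. (For `ϖ ≠ 0` incidence is already a symmetric relation, see `incident_symm`.) -/
def oneSkeleton (ϖ : O) : SimpleGraph (Vertex O F V) := SimpleGraph.fromRel (Incident ϖ)

lemma incident_symm [FaithfulSMul O F] {ϖ : O} (hϖ : ϖ ≠ 0) {x y : Vertex O F V}
    (h : Incident ϖ x y) : Incident ϖ y x := by
  obtain ⟨Λ₁, Λ₂, rfl, rfl, h₁, h₂⟩ := h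
  have h0 : algebraMap O F ϖ ≠ 0 := by
    simpa using (FaithfulSMul.algebraMap_injective O F).ne hϖ
  have key : ((Units.mk0 _ h0 • Λ₁ : OLattice O F V)).1 = ϖ • Λ₁.1 := by
    ext v
    change v ∈ Submodule.map _ _ ↔ v ∈ Submodule.map _ _
    simp [Submodule.mem_map]
  refine ⟨Λ₂, Units.mk0 _ h0 • Λ₁, rfl, Quotient.sound ⟨_, rfl⟩, ?_, ?_⟩
  · rw [key]; exact Submodule.map_mono h₂
  · rw [key]; exact h₁

end Building

section Levi

variable {F V : Type*} [Field F] [AddCommGroup V] [Module F V] {W₁ W₂ : Submodule F V}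

/-- For `V = W₁ ⊕ W₂`, the block-diagonal embedding `GL(W₁) × GL(W₂) → GL(V)`,
`(g₁, g₂)(w₁ + w₂) = g₁ w₁ + g₂ w₂`. -/
noncomputable def leviHom (h : IsCompl W₁ W₂) :
    (W₁ ≃ₗ[F] W₁) × (W₂ ≃ₗ[F] W₂) →* (V ≃ₗ[F] V) where
  toFun g := (W₁.prodEquivOfIsCompl W₂ h).symm ≪≫ₗ g.1.prodCongr g.2 ≪≫ₗ
    W₁.prodEquivOfIsCompl W₂ h
  map_one' := by
    ext v
    exact (W₁.prodEquivOfIsCompl W₂ h).apply_symm_apply v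
  map_mul' g g' := by
    ext v
    simp [LinearEquiv.mul_apply]

/-- The Levi subgroup `L ≅ GL(W₁) × GL(W₂)` of `GL(V)` attached to `V = W₁ ⊕ W₂`. -/
noncomputable def levi (h : IsCompl W₁ W₂) : Subgroup (V ≃ₗ[F] V) := (leviHom h).range

end Levi

/-- `A^n`: weakly decreasing sequences of `n` natural numbers. -/
def Part (n : ℕ) : Type := {α : Fin n → ℕ // Antitone α}

/-- The orbital distance `max_i |α_i - β_i|` (equal to `0` if `n = 0`). -/
def orbitalDist {n : ℕ} (α β : Part n) : ℕ :=
  Finset.univ.sup fun i => ((α.1 i : ℤ) - (β.1 i : ℤ)).natAbs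

section Representatives

variable {O F V : Type*} [CommRing O] [Field F] [Algebra O F]
  [AddCommGroup V] [Module F V] [Module O V] [IsScalarTower O F V]
  {W₁ W₂ : Submodule F V} {n₁ n₂ : ℕ}

/-- The generators of `Λ^α`: the vectors `e_i` (`i < n₁`), the vectors `ϖ^{-α_j} e_j + f_j`
(`j < n₁`), and the vectors `f_j` (`n₁ ≤ j < n₂`). -/
noncomputable def repGen (ϖ : O) (e : Module.Basis (Fin n₁) F W₁) (f : Module.Basis (Fin n₂) F W₂)
    (α : Part n₁) : Fin n₁ ⊕ Fin n₂ → V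
  | .inl i => e i
  | .inr j =>
    if hj : (j : ℕ) < n₁ then
      ((algebraMap O F ϖ)⁻¹ ^ α.1 ⟨j, hj⟩) • (e ⟨j, hj⟩ : V) + f j
    else f j

set_option linter.unusedSectionVars false in
lemma span_repGen (h : IsCompl W₁ W₂) (ϖ : O) (e : Module.Basis (Fin n₁) F W₁)
    (f : Module.Basis (Fin n₂) F W₂) (α : Part n₁) :
    Submodule.span F (Set.range (repGen ϖ e f α)) = ⊤ := by
  set S := Submodule.span F (Set.range (repGen ϖ e f α)) with hS
  have he : ∀ i, (e i : V) ∈ S := fun i => Submodule.subset_span ⟨.inl i, rfl⟩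
  have hf : ∀ j, (f j : V) ∈ S := by
    intro j
    have hj : repGen ϖ e f α (.inr j) ∈ S := Submodule.subset_span ⟨.inr j, rfl⟩
    simp only [repGen] at hj
    split_ifs at hj with hlt
    · exact (S.add_mem_iff_right (S.smul_mem _ (he _))).1 hj
    · exact hj
  have h₁ : W₁ ≤ S := by
    have : Submodule.map W₁.subtype (Submodule.span F (Set.range e)) ≤ S := by
      rw [Submodule.map_span, Submodule.span_le]
      rintro _ ⟨_, ⟨i, rfl⟩, rfl⟩
      exact he i
    simpa [e.span_eq] using this
  have h₂ : W₂ ≤ S := by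
    have : Submodule.map W₂.subtype (Submodule.span F (Set.range f)) ≤ S := by
      rw [Submodule.map_span, Submodule.span_le]
      rintro _ ⟨_, ⟨i, rfl⟩, rfl⟩
      exact hf i
    simpa [f.span_eq] using this
  exact top_le_iff.1 (h.sup_eq_top ▸ sup_le h₁ h₂)

/-- The lattice
`Λ^α = ⊕_{i ≤ n₁} ⟨e_i, ϖ^{-α_i} e_i + f_i⟩_O ⊕ ⊕_{n₁ < j ≤ n₂} O f_j`, for bases
`(e_i)` of `W₁` and `(f_j)` of `W₂`. -/
noncomputable def repLattice (h : IsCompl W₁ W₂) (ϖ : O) (e : Module.Basis (Fin n₁) F W₁)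
    (f : Module.Basis (Fin n₂) F W₂) (α : Part n₁) : OLattice O F V :=
  ⟨Submodule.span O (Set.range (repGen ϖ e f α)),
    { fg := Submodule.fg_span (Set.finite_range _)
      span_eq_top := by
        rw [Submodule.span_span_of_tower, span_repGen h] }⟩

/-- The `L`-orbit of the vertex `[Λ^α]`. -/
noncomputable def repOrbit (h : IsCompl W₁ W₂) (ϖ : O) (e : Module.Basis (Fin n₁) F W₁)
    (f : Module.Basis (Fin n₂) F W₂) (α : Part n₁) :
    MulAction.orbitRel.Quotient (levi h) (Vertex O F V) :=
  Quotient.mk (MulAction.orbitRel (levi h) (Vertex O F V)) (Vertex.mk (repLattice h ϖ e f α))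

end Representatives

end LeviBuilding

/-! Let `p` be the projection to `W₁` along `W₂`. The invariant of a lattice `Λ` is the torsion
module `p(Λ) / (Λ ∩ W₁)`: its isomorphism class is unchanged by `L` and by homotheties, and for
`Λ^α` it is `⊕ O/ϖ^{α_i}`. With indices from `0`, `α_i ≤ k` holds exactly when `ϖ^k` times this
module lies in an `i`-generated submodule (`isApprox_iff_of_mem_orbit`). Crossing an edge costs at
most one extra factor `ϖ` (`Vertex.IsApprox.adj`). This gives both injectivity and the lower bound
on distances.

The bound is attained: some diagonal `g ∈ L` satisfies `ϖ^D Λ^α ≤ g Λ^β ≤ Λ^α` with `D = max |α_i -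
β_i|` (`exists_levi_repGen`), and such a pair is joined by a walk of length at most `D`
(`edist_le_of_pow_smul_le`).

For surjectivity, split `Λ` over its image `Q` in `W₂`, so that `Λ` is recorded by `N = Λ ∩ W₁` and
a map `Q → W₁` modulo `N`. Smith normal form diagonalizes this map; only the polar parts `ϖ^{-a}` of
the entries survive, up to units absorbed into the basis (`exists_eq_repLattice`). -/

namespace LeviBuilding

/-! ### The Levi subgroup: projections and bases. -/

section Levi

variable {F V : Type*} [Field F] [AddCommGroup V] [Module F V] {W₁ W₂ : Submodule F V}

lemma leviHom_apply_left (h : IsCompl W₁ W₂) (g : (W₁ ≃ₗ[F] W₁) × (W₂ ≃ₗ[F] W₂)) (w : W₁) :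
    leviHom h g (w : V) = g.1 w := by
  simp [leviHom]

lemma leviHom_apply_right (h : IsCompl W₁ W₂) (g : (W₁ ≃ₗ[F] W₁) × (W₂ ≃ₗ[F] W₂)) (w : W₂) :
    leviHom h g (w : V) = g.2 w := by
  simp [leviHom]

/-- The only property of `L` needed for the invariance of `IsApprox`. -/
lemma levi_projection (h : IsCompl W₁ W₂) {g : V ≃ₗ[F] V} (hg : g ∈ levi h) (v : V) :
    W₁.projection W₂ h (g v) = g (W₁.projection W₂ h v) := by
  obtain ⟨g, rfl⟩ := hg
  obtain ⟨⟨a, b⟩, rfl⟩ := (W₁.prodEquivOfIsCompl W₂ h).surjective v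
  simp only [Submodule.coe_prodEquivOfIsCompl', map_add, leviHom_apply_left, leviHom_apply_right,
    Submodule.projection_apply_left, Submodule.projection_apply_right, map_zero]

/-- The Levi subgroup acts transitively on pairs of bases of the two summands. -/
lemma exists_mem_levi_apply_basis (h : IsCompl W₁ W₂) {ι₁ ι₂ : Type*}
    (e x : Module.Basis ι₁ F W₁) (f y : Module.Basis ι₂ F W₂) :
    ∃ g ∈ levi h, (∀ i, g (e i : V) = x i) ∧ ∀ j, g (f j : V) = y j :=
  ⟨_, ⟨(e.equiv x (Equiv.refl _), f.equiv y (Equiv.refl _)), rfl⟩,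
    fun i => by rw [leviHom_apply_left]; simp, fun j => by rw [leviHom_apply_right]; simp⟩

end Levi

/-! ### The invariant and its variation along walks. -/

section Approx

variable {O F V : Type*} [CommRing O] [Field F] [Algebra O F]
  [AddCommGroup V] [Module F V] [Module O V] [IsScalarTower O F V]
  {W₁ W₂ : Submodule F V}

/-- The module `ϖ ^ k • (p(Λ) / (Λ ∩ W₁))`, where `p` is the projection to `W₁`, is contained in a
submodule of `W₁ / (Λ ∩ W₁)` generated by `r` elements. -/
def IsApprox (h : IsCompl W₁ W₂) (ϖ : O) (k r : ℕ) (Λ : Submodule O V) : Prop :=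
  ∃ u : Fin r → V, ∀ v ∈ Λ, ϖ ^ k • W₁.projection W₂ h v ∈
    Submodule.span O (Set.range u) ⊔ (Λ ⊓ W₁.restrictScalars O)

/-- Stated for any `g` commuting with the projection, so as to cover both `L` and homotheties. -/
lemma IsApprox.map {h : IsCompl W₁ W₂} {ϖ : O} {k r : ℕ} {Λ : Submodule O V}
    (H : IsApprox h ϖ k r Λ) (g : V ≃ₗ[F] V)
    (hg : ∀ v, W₁.projection W₂ h (g v) = g (W₁.projection W₂ h v)) :
    IsApprox h ϖ k r (Λ.map (g.toLinearMap.restrictScalars O)) := by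
  obtain ⟨u, hu⟩ := H
  refine ⟨fun i => g (u i), ?_⟩
  rintro _ ⟨v, hv, rfl⟩
  have := Submodule.mem_map_of_mem (f := g.toLinearMap.restrictScalars O) (hu v hv)
  rw [Submodule.map_sup, Submodule.map_span, ← Set.range_comp] at this
  simp only [LinearMap.coe_restrictScalars, LinearEquiv.coe_coe, hg]
  rw [map_smul] at this
  refine SetLike.le_def.1 (sup_le_sup_left ?_ _) this
  refine (Submodule.map_inf_le _).trans (inf_le_inf_left _ ?_)
  rintro _ ⟨w, hw, rfl⟩
  have h1 : W₁.projection W₂ h w = w := Submodule.projection_apply_left h ⟨w, hw⟩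
  have h2 := hg w
  rw [h1] at h2
  change g w ∈ W₁
  rw [← h2]
  exact Submodule.projection_apply_mem h _

lemma IsApprox.levi_smul {h : IsCompl W₁ W₂} {ϖ : O} {k r : ℕ} {Λ : OLattice O F V}
    (H : IsApprox h ϖ k r Λ.1) {g : V ≃ₗ[F] V} (hg : g ∈ levi h) :
    IsApprox h ϖ k r (g • Λ).1 :=
  H.map g (levi_projection h hg)

lemma IsApprox.homothety {h : IsCompl W₁ W₂} {ϖ : O} {k r : ℕ} {Λ : OLattice O F V}
    (H : IsApprox h ϖ k r Λ.1) (a : Fˣ) : IsApprox h ϖ k r (a • Λ).1 :=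
  H.map (LinearEquiv.smulOfUnit a) fun v => map_smul _ (a : F) v

/-- `IsApprox` for a homothety class of lattices. -/
def Vertex.IsApprox (h : IsCompl W₁ W₂) (ϖ : O) (k r : ℕ) (x : Vertex O F V) : Prop :=
  ∃ Λ, Vertex.mk Λ = x ∧ LeviBuilding.IsApprox h ϖ k r Λ.1

lemma Vertex.mk_eq_mk_iff {Λ Λ' : OLattice O F V} :
    Vertex.mk Λ = Vertex.mk Λ' ↔ ∃ a : Fˣ, a • Λ' = Λ :=
  (Quotient.eq (r := MulAction.orbitRel Fˣ (OLattice O F V))).trans Iff.rfl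

lemma Vertex.isApprox_mk {h : IsCompl W₁ W₂} {ϖ : O} {k r : ℕ} {Λ : OLattice O F V} :
    (Vertex.mk Λ).IsApprox h ϖ k r ↔ LeviBuilding.IsApprox h ϖ k r Λ.1 := by
  refine ⟨?_, fun H => ⟨Λ, rfl, H⟩⟩
  rintro ⟨Λ', h', H⟩
  obtain ⟨a, rfl⟩ := Vertex.mk_eq_mk_iff.1 h'.symm
  exact H.homothety a

lemma Vertex.IsApprox.levi_smul {h : IsCompl W₁ W₂} {ϖ : O} {k r : ℕ} {x : Vertex O F V}
    (H : x.IsApprox h ϖ k r) {g : V ≃ₗ[F] V} (hg : g ∈ levi h) : (g • x).IsApprox h ϖ k r := by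
  obtain ⟨Λ, rfl, H⟩ := H
  exact ⟨g • Λ, rfl, H.levi_smul hg⟩

lemma Vertex.IsApprox.of_orbit {h : IsCompl W₁ W₂} {ϖ : O} {k r : ℕ} {x y : Vertex O F V}
    (H : x.IsApprox h ϖ k r) (hxy : y ∈ MulAction.orbit (levi h) x) : y.IsApprox h ϖ k r := by
  obtain ⟨g, rfl⟩ := hxy
  exact H.levi_smul g.2

/-- The error term in `Λ ∩ W₁` enters `Λ' ∩ W₁` after one multiplication by `ϖ`. -/
lemma IsApprox.succ_of_le {h : IsCompl W₁ W₂} {ϖ : O} {k r : ℕ} {Λ Λ' : Submodule O V}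
    (H : IsApprox h ϖ k r Λ) (h₁ : ϖ • Λ ≤ Λ') (h₂ : Λ' ≤ Λ) : IsApprox h ϖ (k + 1) r Λ' := by
  obtain ⟨u, hu⟩ := H
  refine ⟨u, fun v hv => ?_⟩
  obtain ⟨a, ha, b, hb, hab⟩ := Submodule.mem_sup.1 (hu v (h₂ hv))
  rw [pow_succ', mul_smul, ← hab, smul_add]
  exact Submodule.add_mem_sup (Submodule.smul_mem _ _ ha)
    ⟨h₁ (Submodule.smul_mem_pointwise_smul _ _ _ hb.1), Submodule.smul_mem _ _ hb.2⟩

/-- Here the extra `ϖ` is spent on the vector: `ϖ • v` already lies in `Λ'`. -/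
lemma IsApprox.succ_of_ge {h : IsCompl W₁ W₂} {ϖ : O} {k r : ℕ} {Λ Λ' : Submodule O V}
    (H : IsApprox h ϖ k r Λ') (h₁ : ϖ • Λ ≤ Λ') (h₂ : Λ' ≤ Λ) : IsApprox h ϖ (k + 1) r Λ := by
  obtain ⟨u, hu⟩ := H
  refine ⟨u, fun v hv => ?_⟩
  have := hu (ϖ • v) (h₁ (Submodule.smul_mem_pointwise_smul _ _ _ hv))
  rw [pow_succ, mul_smul, ← LinearMap.map_smul_of_tower]
  exact SetLike.le_def.1 (sup_le_sup_left (inf_le_inf_right _ h₂) _) this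

lemma Vertex.IsApprox.adj {h : IsCompl W₁ W₂} {ϖ : O} {k r : ℕ} {x y : Vertex O F V}
    (H : x.IsApprox h ϖ k r) (hxy : (oneSkeleton F V ϖ).Adj x y) : y.IsApprox h ϖ (k + 1) r := by
  obtain ⟨-, ⟨Λ, Λ', rfl, rfl, h₁, h₂⟩ | ⟨Λ, Λ', rfl, rfl, h₁, h₂⟩⟩ := hxy
  · exact ⟨_, rfl, (isApprox_mk.1 H).succ_of_le h₁ h₂⟩
  · exact ⟨_, rfl, (isApprox_mk.1 H).succ_of_ge h₁ h₂⟩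

lemma Vertex.IsApprox.walk {h : IsCompl W₁ W₂} {ϖ : O} {k r : ℕ} {x y : Vertex O F V}
    (H : x.IsApprox h ϖ k r) (p : (oneSkeleton F V ϖ).Walk x y) :
    y.IsApprox h ϖ (k + p.length) r := by
  induction p generalizing k with
  | nil => exact H
  | cons hadj p ih =>
    have := ih (H.adj hadj)
    rwa [SimpleGraph.Walk.length_cons, add_comm p.length 1, ← add_assoc]

end Approx

/-! ### The invariant of `Λ^α`. -/

section RepApprox

variable {O F V : Type*} [CommRing O] [Field F] [Algebra O F]
  [AddCommGroup V] [Module F V] [Module O V] [IsScalarTower O F V]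
  {W₁ W₂ : Submodule F V} {n₁ n₂ : ℕ}

set_option linter.unusedSectionVars false in
lemma projection_repGen_inr (h : IsCompl W₁ W₂) (ϖ : O) (e : Module.Basis (Fin n₁) F W₁)
    (f : Module.Basis (Fin n₂) F W₂) (α : Part n₁) (j : Fin n₂) :
    W₁.projection W₂ h (repGen ϖ e f α (.inr j)) =
      if hj : (j : ℕ) < n₁ then ((algebraMap O F ϖ)⁻¹ ^ α.1 ⟨j, hj⟩) • (e ⟨j, hj⟩ : V) else 0 := by
  simp only [repGen]
  split_ifs with hj <;> simp

/-- For `j ≥ i` monotonicity gives `α_j ≤ k`, so `ϖ^k ϖ^{-α_j} e_j` is already in `Λ^α ∩ W₁`; the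
`i` smaller indices supply the generators `u`. -/
lemma isApprox_repLattice_of_le (h : IsCompl W₁ W₂) {ϖ : O} (hϖ : algebraMap O F ϖ ≠ 0)
    (e : Module.Basis (Fin n₁) F W₁)
    (f : Module.Basis (Fin n₂) F W₂) (α : Part n₁) {i : Fin n₁} {k : ℕ} (hk : α.1 i ≤ k) :
    IsApprox h ϖ k i (repLattice h ϖ e f α).1 := by
  have he : ∀ j, (e j : V) ∈ (repLattice h ϖ e f α).1 ⊓ W₁.restrictScalars O := fun j =>
    ⟨Submodule.subset_span ⟨.inl j, rfl⟩, (e j).2⟩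
  refine ⟨fun j => ϖ ^ k • ((algebraMap O F ϖ)⁻¹ ^ α.1 ⟨j, j.2.trans i.2⟩) •
    (e ⟨j, j.2.trans i.2⟩ : V), fun v hv => ?_⟩
  set S := Submodule.span O (Set.range fun j : Fin i =>
    ϖ ^ k • ((algebraMap O F ϖ)⁻¹ ^ α.1 ⟨j, j.2.trans i.2⟩) •
    (e ⟨j, j.2.trans i.2⟩ : V)) ⊔ ((repLattice h ϖ e f α).1 ⊓ W₁.restrictScalars O) with hS
  suffices (repLattice h ϖ e f α).1 ≤
      S.comap (ϖ ^ k • (W₁.projection W₂ h).restrictScalars O) from this hv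
  refine Submodule.span_le.2 ?_
  rintro _ ⟨j | j, rfl⟩
  · change ϖ ^ k • W₁.projection W₂ h (e j : V) ∈ S
    rw [Submodule.projection_apply_left]
    exact S.smul_mem _ (Submodule.mem_sup_right (he j))
  · change ϖ ^ k • W₁.projection W₂ h (repGen ϖ e f α (.inr j)) ∈ S
    rw [projection_repGen_inr]
    split_ifs with hj
    · by_cases hji : (j : ℕ) < i
      · exact Submodule.mem_sup_left (Submodule.subset_span ⟨⟨j, hji⟩, rfl⟩)
      · have h1 : α.1 ⟨j, hj⟩ ≤ k := (α.2 (Fin.le_def.2 (not_lt.1 hji))).trans hk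
        have h2 : ϖ ^ k • ((algebraMap O F ϖ)⁻¹ ^ α.1 ⟨j, hj⟩) • (e ⟨j, hj⟩ : V) =
            ϖ ^ (k - α.1 ⟨j, hj⟩) • (e ⟨j, hj⟩ : V) := by
          rw [← algebraMap_smul F (ϖ ^ k), ← algebraMap_smul F (ϖ ^ (k - _)), smul_smul]
          congr 1
          rw [map_pow, map_pow, inv_pow, ← pow_sub₀ _ hϖ h1]
        rw [h2]
        exact S.smul_mem _ (Submodule.mem_sup_right (he _))
    · simp

/-- The coordinates with respect to `e` of the elements of `Λ^α ∩ W₁` are integral. -/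
lemma repr_mem_range_of_mem_repLattice_inf (h : IsCompl W₁ W₂) [FaithfulSMul O F] (ϖ : O)
    (e : Module.Basis (Fin n₁) F W₁)
    (f : Module.Basis (Fin n₂) F W₂) (α : Part n₁) {w : W₁}
    (hw : (w : V) ∈ (repLattice h ϖ e f α).1) (i : Fin n₁) :
    ∃ a : O, algebraMap O F a = e.repr w i := by
  have hw' : (w : V) ∈ Submodule.span O (Set.range (repGen ϖ e f α)) := hw
  obtain ⟨c, hc⟩ := (Submodule.mem_span_range_iff_exists_fun O).1 hw'
  rw [Fintype.sum_sum_type] at hc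
  -- Projecting to `W₂` isolates the coefficients of the `.inr` generators, which vanish since the
  -- `f j` are independent.
  have hp2 := congrArg (W₂.projectionOnto W₁ h.symm) hc
  have hf : ∀ j, W₂.projectionOnto W₁ h.symm (repGen ϖ e f α (.inr j)) = f j := by
    intro j
    simp only [repGen]
    split_ifs <;> simp
  have hinl : ∀ i, repGen ϖ e f α (.inl i) = e i := fun _ => rfl
  simp only [map_add, map_sum, LinearMap.map_smul_of_tower, hf, hinl,
    Submodule.projectionOnto_apply_right, smul_zero, Finset.sum_const_zero, zero_add] at hp2
  have hcj : ∀ j, c (.inr j) = 0 := by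
    have hli : LinearIndependent O f := f.linearIndependent.restrict_scalars' O
    exact Fintype.linearIndependent_iff.1 hli _ hp2
  simp only [hcj, zero_smul, Finset.sum_const_zero, add_zero, hinl] at hc
  have hc' : ∑ i, c (.inl i) • e i = w := Subtype.ext (by push_cast; exact hc)
  refine ⟨c (.inl i), ?_⟩
  rw [← hc']
  simp only [← algebraMap_smul F (c _), map_sum, map_smul, Module.Basis.repr_self]
  simp [Finsupp.single_apply, Algebra.smul_def]

/-- If every relation is divisible by `ϖ` then there are none. -/
lemma injective_of_forall_ker_dvd [IsDomain O] [IsDiscreteValuationRing O] {ϖ : O}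
    (hϖ : Irreducible ϖ) {m r : ℕ} (T : (Fin m → O) →ₗ[O] (Fin r → O))
    (hT : ∀ a, T a = 0 → ∀ i, ϖ ∣ a i) : Function.Injective T := by
  -- Nakayama: the target is torsion-free, so dividing a kernel element by `ϖ` stays in the kernel,
  -- and the kernel equals `𝔪` times itself.
  rw [← LinearMap.ker_eq_bot, eq_bot_iff]
  refine Submodule.le_of_le_smul_of_le_jacobson_bot (I := IsLocalRing.maximalIdeal O)
    (IsNoetherian.noetherian _) (IsLocalRing.maximalIdeal_le_jacobson _) ?_
  rw [bot_sup_eq]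
  intro a ha
  choose b hb using hT a ha
  have hab : a = ϖ • b := funext hb
  rw [hab] at ha ⊢
  refine Submodule.smul_mem_smul ?_ ?_
  · rw [hϖ.maximalIdeal_eq]; exact Ideal.mem_span_singleton_self ϖ
  · rw [LinearMap.mem_ker, map_smul] at ha
    exact (smul_eq_zero.1 ha).resolve_left hϖ.ne_zero

/-- If `k < α_i`, the `i + 1` vectors `ϖ⁻¹ e_j`, `j ≤ i`, are combinations of `i` vectors modulo
`Λ^α ∩ W₁`. A relation `a` between the coefficient rows puts `∑ a_j ϖ⁻¹ e_j` in `Λ^α ∩ W₁`, so `ϖ`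
divides every `a_j`. Hence `O^{i+1}` embeds in `O^i`, which is absurd. -/
lemma le_of_isApprox_repLattice [IsDomain O] [IsDiscreteValuationRing O] [FaithfulSMul O F]
    (h : IsCompl W₁ W₂) {ϖ : O} (hϖ : Irreducible ϖ)
    (e : Module.Basis (Fin n₁) F W₁) (f : Module.Basis (Fin n₂) F W₂) (hn : n₁ ≤ n₂)
    (α : Part n₁) {i : Fin n₁} {k : ℕ}
    (H : IsApprox h ϖ k i (repLattice h ϖ e f α).1) : α.1 i ≤ k := by
  by_contra! hk
  obtain ⟨u, hu⟩ := H
  have hϖ0 : algebraMap O F ϖ ≠ 0 := by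
    simpa using (FaithfulSMul.algebraMap_injective O F).ne hϖ.ne_zero
  have hj : ∀ j : Fin (i + 1), ∃ c : Fin i → O, ∃ w : W₁, (w : V) ∈ (repLattice h ϖ e f α).1 ∧
      (algebraMap O F ϖ)⁻¹ • (e ⟨j, by omega⟩ : V) = ∑ l, c l • u l + w := by
    intro j
    have hjn : (j : ℕ) < n₁ := by omega
    have hα : k + 1 ≤ α.1 ⟨j, hjn⟩ := Nat.succ_le_of_lt hk |>.trans
      (α.2 (a := ⟨j, hjn⟩) (b := i) (Fin.le_def.2 (Nat.lt_succ_iff.1 j.2)))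
    have h1 := hu (repGen ϖ e f α (.inr ⟨j, by omega⟩)) (Submodule.subset_span ⟨_, rfl⟩)
    rw [projection_repGen_inr, dif_pos hjn] at h1
    have h2 := Submodule.smul_mem _ (ϖ ^ (α.1 ⟨j, hjn⟩ - (k + 1))) h1
    have h3 : ϖ ^ (α.1 ⟨j, hjn⟩ - (k + 1)) • ϖ ^ k • (algebraMap O F ϖ)⁻¹ ^ α.1 ⟨j, hjn⟩ •
        (e ⟨j, hjn⟩ : V) = (algebraMap O F ϖ)⁻¹ • (e ⟨j, hjn⟩ : V) := by
      rw [smul_smul, ← pow_add, ← algebraMap_smul F (ϖ ^ _), smul_smul]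
      congr 1
      obtain ⟨m, hm⟩ := Nat.exists_eq_add_of_le hα
      rw [hm, map_pow, show k + 1 + m - (k + 1) + k = k + m by omega]
      rw [inv_pow, mul_inv_eq_iff_eq_mul₀ (by simp [hϖ0])]
      field_simp
      ring
    simp only [h3] at h2
    obtain ⟨a, ha, b, hb, hab⟩ := Submodule.mem_sup.1 h2
    obtain ⟨c, rfl⟩ := (Submodule.mem_span_range_iff_exists_fun O).1 ha
    exact ⟨c, ⟨b, hb.2⟩, hb.1, hab.symm⟩
  choose c w hw hcw using hj
  have hinj := injective_of_forall_ker_dvd hϖ (Matrix.vecMulLinear (Matrix.of c)) ?_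
  · have := LinearMap.finrank_le_finrank_of_injective hinj
    simp at this
  intro a ha j
  have hsum : ∑ j, a j • ∑ l, c j l • u l = 0 := by
    simp only [Finset.smul_sum, smul_smul]
    rw [Finset.sum_comm]
    refine Finset.sum_eq_zero fun l _ => ?_
    rw [← Finset.sum_smul]
    have : ∑ j, a j * c j l = 0 := congrFun ha l
    rw [this, zero_smul]
  have hrel : ∑ j, a j • (algebraMap O F ϖ)⁻¹ • e ⟨j, by omega⟩ = ∑ j, a j • w j := by
    apply Subtype.ext
    push_cast
    simp only [hcw, smul_add, Finset.sum_add_distrib, hsum, zero_add]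
  have hmem : ((∑ j, a j • w j : W₁) : V) ∈ (repLattice h ϖ e f α).1 := by
    push_cast
    exact Submodule.sum_mem _ fun j _ => Submodule.smul_mem _ _ (hw j)
  obtain ⟨b, hb⟩ := repr_mem_range_of_mem_repLattice_inf h ϖ e f α hmem ⟨j, by omega⟩
  rw [← hrel] at hb
  simp only [← algebraMap_smul F (a _), map_sum, map_smul, Module.Basis.repr_self] at hb
  simp [Finsupp.single_apply, Fin.val_inj] at hb
  refine ⟨b, FaithfulSMul.algebraMap_injective O F ?_⟩
  rw [map_mul, hb, Algebra.smul_def]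
  field_simp

end RepApprox

/-! ### Short walks and the upper bound. -/

section Lattices

variable {O F V : Type*} [CommRing O] [Field F] [Algebra O F]
  [AddCommGroup V] [Module F V] [Module O V] [IsScalarTower O F V]
  {W₁ W₂ : Submodule F V} {n₁ n₂ : ℕ}

/-- The walk passes through `Λ' + ϖ^j Λ`. Consecutive vertices may coincide, hence an inequality;
`edist` avoids assuming connectedness. -/
lemma edist_le_of_pow_smul_le {ϖ : O} {D : ℕ} {Λ Λ' : OLattice O F V}
    (h₁ : ϖ ^ D • Λ.1 ≤ Λ'.1) (h₂ : Λ'.1 ≤ Λ.1) :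
    (oneSkeleton F V ϖ).edist (Vertex.mk Λ) (Vertex.mk Λ') ≤ D := by
  induction D generalizing Λ with
  | zero =>
    rw [pow_zero, one_smul] at h₁
    rw [Subtype.ext (le_antisymm h₁ h₂)]
    simp
  | succ D ih =>
    have hle : ϖ • Λ.1 ≤ Λ.1 := by
      rintro _ ⟨v, hv, rfl⟩
      exact Λ.1.smul_mem _ hv
    let M : OLattice O F V := ⟨Λ'.1 ⊔ ϖ • Λ.1,
      haveI := Λ'.2
      Submodule.IsLattice.of_le_of_isLattice_of_fg F (le_sup_left : Λ'.1 ≤ _)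
        (Λ'.2.fg.sup (Λ.2.fg.map _))⟩
    have hM : (oneSkeleton F V ϖ).edist (Vertex.mk Λ) (Vertex.mk M) ≤ 1 := by
      rw [SimpleGraph.edist_le_one_iff_adj_or_eq]
      by_cases heq : Vertex.mk Λ = Vertex.mk M
      · exact .inr heq
      · exact .inl ⟨heq, .inl ⟨Λ, M, rfl, rfl, le_sup_right, sup_le h₂ hle⟩⟩
    have hM' : (oneSkeleton F V ϖ).edist (Vertex.mk M) (Vertex.mk Λ') ≤ D := by
      refine ih ?_ le_sup_left
      change ϖ ^ D • (Λ'.1 ⊔ ϖ • Λ.1) ≤ _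
      rw [Submodule.smul_sup', smul_smul, ← pow_succ]
      refine sup_le ?_ h₁
      rintro _ ⟨v, hv, rfl⟩
      exact Λ'.1.smul_mem _ hv
    calc _ ≤ _ := SimpleGraph.edist_triangle
      _ ≤ (1 : ℕ∞) + D := add_le_add hM hM'
      _ = _ := by push_cast; rw [add_comm]

lemma coe_smul_repLattice (h : IsCompl W₁ W₂) (ϖ : O) (e : Module.Basis (Fin n₁) F W₁)
    (f : Module.Basis (Fin n₂) F W₂) (α : Part n₁) (g : V ≃ₗ[F] V) :
    (g • repLattice h ϖ e f α).1 = Submodule.span O (Set.range fun s => g (repGen ϖ e f α s)) := by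
  change Submodule.map _ (Submodule.span O _) = _
  rw [Submodule.map_span, ← Set.range_comp]
  rfl

/-- A block-diagonal element moves the generators of `Λ^β` to multiples of those of `Λ^α`, with
exponents bounded by the orbital distance. -/
lemma exists_levi_repGen (h : IsCompl W₁ W₂) {ϖ : O} (hϖ : algebraMap O F ϖ ≠ 0)
    (e : Module.Basis (Fin n₁) F W₁) (f : Module.Basis (Fin n₂) F W₂) (α β : Part n₁) :
    ∃ g ∈ levi h, ∃ c : Fin n₁ ⊕ Fin n₂ → ℕ, (∀ s, c s ≤ orbitalDist α β) ∧
      ∀ s, g (repGen ϖ e f β s) = ϖ ^ c s • repGen ϖ e f α s := by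
  have hD : ∀ i, ((α.1 i : ℤ) - (β.1 i : ℤ)).natAbs ≤ orbitalDist α β := fun i =>
    Finset.le_sup (f := fun i => ((α.1 i : ℤ) - (β.1 i : ℤ)).natAbs) (Finset.mem_univ i)
  -- Truncated subtraction is intended: `c₁` and `c₂` are the positive parts of `β - α` and `α - β`,
  -- so `c₁ + α = c₂ + β = max(α, β)`. This makes `g` scale both terms of `ϖ^{-β_j} e_j + f_j`
  -- compatibly.
  let c₁ : Fin n₁ → ℕ := fun i => β.1 i - α.1 i
  let c₂ : Fin n₂ → ℕ := fun j => if hj : (j : ℕ) < n₁ then α.1 ⟨j, hj⟩ - β.1 ⟨j, hj⟩ else 0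
  obtain ⟨g, hg, hge, hgf⟩ := exists_mem_levi_apply_basis h e
    (e.unitsSMul fun i => Units.mk0 _ hϖ ^ c₁ i) f (f.unitsSMul fun j => Units.mk0 _ hϖ ^ c₂ j)
  refine ⟨g, hg, Sum.elim c₁ c₂, ?_, ?_⟩
  · rintro (i | j)
    · have := hD i
      simp only [Sum.elim_inl, c₁]
      omega
    · simp only [Sum.elim_inr, c₂]
      split_ifs with hj
      · have := hD ⟨j, hj⟩
        omega
      · exact Nat.zero_le _
  · rintro (i | j)
    · simp only [repGen, hge, Sum.elim_inl, Module.Basis.unitsSMul_apply]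
      rw [← algebraMap_smul F (ϖ ^ _), map_pow]
      rfl
    · simp only [repGen, Sum.elim_inr]
      split_ifs with hj
      · rw [map_add, map_smul, hge, hgf, Module.Basis.unitsSMul_apply, Module.Basis.unitsSMul_apply,
          ← algebraMap_smul F (ϖ ^ _), map_pow, smul_add]
        congr 1
        change _ • ((algebraMap O F ϖ) ^ c₁ ⟨j, hj⟩) • (e ⟨j, hj⟩ : V) = _
        rw [smul_smul, smul_smul]
        congr 1
        have : c₁ ⟨j, hj⟩ + α.1 ⟨j, hj⟩ = c₂ j + β.1 ⟨j, hj⟩ := by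
          simp only [c₁, c₂, dif_pos hj]
          omega
        rw [inv_pow, inv_pow, inv_mul_eq_iff_eq_mul₀ (pow_ne_zero _ hϖ), ← mul_assoc,
          eq_mul_inv_iff_mul_eq₀ (pow_ne_zero _ hϖ), ← pow_add, ← pow_add, this, add_comm]
      · rw [hgf, Module.Basis.unitsSMul_apply, ← algebraMap_smul F (ϖ ^ _), map_pow]
        rfl

lemma exists_levi_edist_le (h : IsCompl W₁ W₂) {ϖ : O} (hϖ : algebraMap O F ϖ ≠ 0)
    (e : Module.Basis (Fin n₁) F W₁) (f : Module.Basis (Fin n₂) F W₂) (α β : Part n₁) :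
    ∃ g ∈ levi h, (oneSkeleton F V ϖ).edist (Vertex.mk (repLattice h ϖ e f α))
      (g • Vertex.mk (repLattice h ϖ e f β)) ≤ orbitalDist α β := by
  obtain ⟨g, hg, c, hc, hgc⟩ := exists_levi_repGen h hϖ e f α β
  refine ⟨g, hg, edist_le_of_pow_smul_le (Λ' := g • repLattice h ϖ e f β) ?_ ?_⟩
  · rw [coe_smul_repLattice]
    change Submodule.map _ (Submodule.span O _) ≤ _
    rw [Submodule.map_span, Submodule.span_le]
    rintro _ ⟨_, ⟨s, rfl⟩, rfl⟩
    change ϖ ^ orbitalDist α β • repGen ϖ e f α s ∈ Submodule.span O _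
    rw [← Nat.sub_add_cancel (hc s), pow_add, mul_smul, ← hgc]
    exact Submodule.smul_mem _ _ (Submodule.subset_span ⟨s, rfl⟩)
  · rw [coe_smul_repLattice, Submodule.span_le]
    rintro _ ⟨s, rfl⟩
    simp only [hgc]
    exact Submodule.smul_mem _ _ (Submodule.subset_span ⟨s, rfl⟩)

lemma isLattice_map_projectionOnto (h : IsCompl W₁ W₂) {Λ : Submodule O V}
    (hΛ : Submodule.IsLattice F Λ) :
    Submodule.IsLattice F (Λ.map ((W₁.projectionOnto W₂ h).restrictScalars O)) where
  fg := hΛ.fg.map _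
  span_eq_top := by
    have : ((Λ.map ((W₁.projectionOnto W₂ h).restrictScalars O) : Submodule O W₁) : Set W₁) =
      W₁.projectionOnto W₂ h '' (Λ : Set V) := rfl
    rw [this, ← Submodule.map_span, hΛ.span_eq_top, Submodule.map_top,
      Submodule.range_projectionOnto]

/-- The orbit of `Λ^α` is independent of the bases, so surjectivity only requires bases adapted to a
given lattice. -/
lemma exists_levi_smul_repLattice (h : IsCompl W₁ W₂) (ϖ : O)
    (e x : Module.Basis (Fin n₁) F W₁) (f y : Module.Basis (Fin n₂) F W₂) (α : Part n₁) :
    ∃ g ∈ levi h, g • repLattice h ϖ e f α = repLattice h ϖ x y α := by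
  obtain ⟨g, hg, hge, hgf⟩ := exists_mem_levi_apply_basis h e x f y
  refine ⟨g, hg, Subtype.ext ?_⟩
  rw [coe_smul_repLattice]
  change _ = Submodule.span O (Set.range (repGen ϖ x y α))
  congr 2
  funext s
  rcases s with i | j
  · exact hge i
  · simp only [repGen]
    split_ifs
    · rw [map_add, map_smul, hge, hgf]
    · exact hgf j

end Lattices

/-! ### Smith normal form for maps. -/

section Smith

/-- Smith normal form of a linear map between finite free modules over a principal ideal domain. -/
lemma exists_bases_smith {R M N ι κ : Type*} [CommRing R] [IsDomain R] [IsPrincipalIdealRing R]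
    [AddCommGroup M] [Module R M] [AddCommGroup N] [Module R N] [Fintype ι] [Fintype κ]
    (b : Module.Basis ι R N) (b' : Module.Basis κ R M) (θ : ι ↪ κ) (ψ : M →ₗ[R] N) :
    ∃ (bN : Module.Basis ι R N) (bM : Module.Basis κ R M) (c : ι → R),
      (∀ i, ψ (bM (θ i)) = c i • bN i) ∧ ∀ j ∉ Set.range θ, ψ (bM j) = 0 := by
  classical
  have : Module.Free R M := .of_basis b'
  have : Module.Finite R M := .of_basis b'
  obtain ⟨r, snf⟩ := Submodule.smithNormalForm b (LinearMap.range ψ)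
  have : Module.Free R (LinearMap.range ψ) := .of_basis snf.bN
  -- The range is free, so `M` is the kernel plus a lift of the range; a basis of `M` is assembled
  -- from both.
  obtain ⟨s, hs⟩ := Module.projective_lifting_property ψ.rangeRestrict .id
    ψ.surjective_rangeRestrict
  have hs' : ∀ z, ψ (s z) = z := fun z => congrArg Subtype.val (LinearMap.congr_fun hs z)
  obtain ⟨k, bK⟩ := Submodule.basisOfPid b' (LinearMap.ker ψ)
  let T : (LinearMap.ker ψ × LinearMap.range ψ) ≃ₗ[R] M :=
    LinearEquiv.ofBijective ((LinearMap.ker ψ).subtype.coprod s) <| by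
      constructor
      · rw [← LinearMap.ker_eq_bot, eq_bot_iff]
        rintro ⟨z, w⟩ h
        have h1 : (z : M) + s w = 0 := h
        have h2 := congrArg ψ h1
        rw [map_add, hs', z.2, zero_add, map_zero] at h2
        have hw : w = 0 := Subtype.ext h2
        subst hw
        have hz : z = 0 := Subtype.ext (by simpa using h1)
        subst hz
        rfl
      · intro m
        refine ⟨(⟨m - s (ψ.rangeRestrict m), ?_⟩, ψ.rangeRestrict m), ?_⟩
        · rw [LinearMap.mem_ker, map_sub, hs']; simp
        · simp
  have hT : ∀ z, T z = (z.1 : M) + s z.2 := fun _ => rfl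
  let B := (bK.prod snf.bN).map T
  have hBl : ∀ l, ψ (B (.inl l)) = 0 := fun l => by simp [B, hT]
  have hBr : ∀ l, ψ (B (.inr l)) = snf.a l • snf.bM (snf.f l) := fun l => by
    simp [B, hT, hs', snf.snf]
  have hcard : Fintype.card (Fin k ⊕ Fin r) = (Finset.univ : Finset κ).card :=
    Fintype.card_congr (B.indexEquiv b')
  -- Reindex so that the lift attached to `snf.bM (snf.f l)` sits at `θ (snf.f l)`; kernel vectors
  -- fill the other places, where the coefficient defaults to `0`.
  obtain ⟨ε, hε⟩ := Set.MapsTo.exists_equiv_extend_of_card_eq (s := Set.range Sum.inr)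
    (f := Sum.elim (fun l => B.indexEquiv b' (.inl l)) fun l => θ (snf.f l)) hcard
    (fun _ _ => Finset.mem_coe.2 (Finset.mem_univ _)) (by
      rintro _ ⟨l, rfl⟩ _ ⟨l', rfl⟩ h
      exact congrArg Sum.inr (snf.f.injective (θ.injective h)))
  let ε' : Fin k ⊕ Fin r ≃ κ := ε.trans (Equiv.subtypeUnivEquiv fun _ => Finset.mem_univ _)
  have hε' : ∀ l, ε' (.inr l) = θ (snf.f l) := fun l => hε _ ⟨l, rfl⟩
  refine ⟨snf.bM, B.reindex ε', Function.extend snf.f snf.a 0, fun i => ?_, fun j hj => ?_⟩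
  · rw [Module.Basis.reindex_apply]
    rcases hl : ε'.symm (θ i) with l | l
    · rw [hBl, Function.extend_apply', Pi.zero_apply, zero_smul]
      rintro ⟨l', rfl⟩
      rw [← hε', Equiv.symm_apply_apply] at hl
      cases hl
    · rw [Equiv.symm_apply_eq, hε'] at hl
      rw [θ.injective hl, snf.f.injective.extend_apply, hBr]
  · rw [Module.Basis.reindex_apply]
    rcases hl : ε'.symm j with l | l
    · exact hBl l
    · rw [Equiv.symm_apply_eq, hε'] at hl
      exact absurd ⟨_, hl.symm⟩ hj

end Smith

/-! ### Denominators and intersections with subspaces. -/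

section Fraction

variable {O F V : Type*} [CommRing O] [IsDomain O] [Field F] [Algebra O F] [IsFractionRing O F]
  [AddCommGroup V] [Module F V] [Module O V] [IsScalarTower O F V]

lemma exists_smul_mem_of_isLattice {Λ : Submodule O V} (hΛ : Submodule.IsLattice F Λ) (v : V) :
    ∃ d : O, d ≠ 0 ∧ d • v ∈ Λ := by
  have hv : v ∈ Submodule.span F (Λ : Set V) := hΛ.span_eq_top ▸ Submodule.mem_top
  induction hv using Submodule.span_induction with
  | mem x hx => exact ⟨1, one_ne_zero, by simpa using hx⟩
  | zero => exact ⟨1, one_ne_zero, by simp⟩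
  | add x y _ _ hx hy =>
    obtain ⟨d, hd, hdx⟩ := hx
    obtain ⟨d', hd', hdy⟩ := hy
    refine ⟨d * d', mul_ne_zero hd hd', ?_⟩
    rw [smul_add, mul_smul d d' y, mul_comm, mul_smul]
    exact Λ.add_mem (Λ.smul_mem _ hdx) (Λ.smul_mem _ hdy)
  | smul a x _ hx =>
    obtain ⟨d, hd, hdx⟩ := hx
    obtain ⟨p, q, hq, rfl⟩ := IsFractionRing.div_surjective (A := O) a
    refine ⟨d * q, mul_ne_zero hd (nonZeroDivisors.ne_zero hq), ?_⟩
    have hq0 : algebraMap O F q ≠ 0 := by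
      simpa using (FaithfulSMul.algebraMap_injective O F).ne (nonZeroDivisors.ne_zero hq)
    have : (d * q) • (algebraMap O F p / algebraMap O F q) • x = p • d • x := by
      rw [← algebraMap_smul F (d * q), ← algebraMap_smul F d, ← algebraMap_smul F p, smul_smul,
        smul_smul, map_mul]
      congr 1
      field_simp
    rw [this]
    exact Λ.smul_mem _ hdx

lemma exists_smul_le_of_isLattice {Λ : Submodule O V} (hΛ : Submodule.IsLattice F Λ)
    {S : Submodule O V} (hS : S.FG) : ∃ d : O, d ≠ 0 ∧ ∀ v ∈ S, d • v ∈ Λ := by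
  induction S, hS using Submodule.fg_induction with
  | singleton x =>
    obtain ⟨d, hd, hx⟩ := exists_smul_mem_of_isLattice hΛ x
    refine ⟨d, hd, fun v hv => ?_⟩
    obtain ⟨a, rfl⟩ := Submodule.mem_span_singleton.1 hv
    rw [smul_comm]
    exact Λ.smul_mem _ hx
  | sup S T _ _ hS hT =>
    obtain ⟨d, hd, hdS⟩ := hS
    obtain ⟨d', hd', hdT⟩ := hT
    refine ⟨d * d', mul_ne_zero hd hd', fun v hv => ?_⟩
    obtain ⟨x, hx, y, hy, rfl⟩ := Submodule.mem_sup.1 hv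
    rw [smul_add, mul_smul d d' y, mul_comm, mul_smul]
    exact Λ.add_mem (Λ.smul_mem _ (hdS x hx)) (Λ.smul_mem _ (hdT y hy))

/-- Modulo integral elements, every element of `F` is a unit times some `ϖ⁻¹ ^ a`, `a ≥ 0`. -/
lemma exists_eq_unit_mul_inv_pow_add [IsDiscreteValuationRing O] {ϖ : O} (hϖ : Irreducible ϖ)
    (c : F) : ∃ (a : ℕ) (v : Oˣ) (o : O),
      c = algebraMap O F v * (algebraMap O F ϖ)⁻¹ ^ a + algebraMap O F o := by
  have integral : ∀ o : O, ∃ (a : ℕ) (v : Oˣ) (o' : O),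
      algebraMap O F o = algebraMap O F v * (algebraMap O F ϖ)⁻¹ ^ a + algebraMap O F o' :=
    -- An integral entry, even `0`, gets exponent `0` and unit `1`: at `α_i = 0` the generator is
    -- `e_i + f_i`.
    fun o => ⟨0, 1, o - 1, by simp⟩
  rcases eq_or_ne c 0 with rfl | hc
  · simpa using integral 0
  obtain ⟨n, u, hu⟩ := IsDiscreteValuationRing.exists_units_eq_smul_zpow_of_irreducible hϖ hc
  rcases n with n | n
  · convert integral (u * ϖ ^ n) using 6
    rw [hu, Units.smul_def, Algebra.smul_def]
    simp
  · refine ⟨n + 1, u, 0, ?_⟩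
    rw [hu, Units.smul_def, Algebra.smul_def, zpow_negSucc]
    simp

variable {W₁ W₂ : Submodule F V}

/-- The intersection of a lattice with a subspace. -/
lemma isLattice_comap_subtype [IsNoetherianRing O] {Λ : Submodule O V}
    (hΛ : Submodule.IsLattice F Λ) :
    Submodule.IsLattice F (Λ.comap (W₁.subtype.restrictScalars O)) where
  fg := by
    have : IsNoetherian O Λ := isNoetherian_of_fg_of_noetherian _ hΛ.fg
    have hinj : Function.Injective (W₁.subtype.restrictScalars O) := Subtype.val_injective
    refine Submodule.fg_of_fg_map_injective _ hinj ?_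
    have := isNoetherian_of_le (Submodule.map_comap_le (W₁.subtype.restrictScalars O) Λ)
    exact Module.Finite.iff_fg.1 inferInstance
  span_eq_top := by
    refine eq_top_iff.2 fun w _ => ?_
    obtain ⟨d, hd, hdw⟩ := exists_smul_mem_of_isLattice hΛ (w : V)
    have hd0 : algebraMap O F d ≠ 0 := by
      simpa using (FaithfulSMul.algebraMap_injective O F).ne hd
    have : w = (algebraMap O F d)⁻¹ • d • w := by
      rw [← algebraMap_smul F d, smul_smul, inv_mul_cancel₀ hd0, one_smul]
    rw [this]
    exact Submodule.smul_mem _ _ (Submodule.subset_span hdw)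

end Fraction

/-! ### Adapted bases for an arbitrary lattice. -/

section Representatives

variable {O F V : Type*} [CommRing O] [IsDomain O] [IsDiscreteValuationRing O]
  [Field F] [Algebra O F] [IsFractionRing O F]
  [AddCommGroup V] [Module F V] [Module O V] [IsScalarTower O F V]
  {W₁ W₂ : Submodule F V} {n₁ n₂ : ℕ}

lemma exists_basis_of_isLattice {ι : Type*} [Finite ι] (e : Module.Basis ι F V)
    {Λ : Submodule O V} (hΛ : Submodule.IsLattice F Λ) : Nonempty (Module.Basis ι O Λ) := by
  have b := Module.Free.chooseBasis O Λ
  exact ⟨b.reindex ((b.extendOfIsLattice F).indexEquiv e)⟩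

/-- Every lattice is `Λ^α` for suitable bases of `W₁` and `W₂`. -/
lemma exists_eq_repLattice (h : IsCompl W₁ W₂) {ϖ : O} (hϖ : Irreducible ϖ) (hn : n₁ ≤ n₂)
    (e : Module.Basis (Fin n₁) F W₁) (f : Module.Basis (Fin n₂) F W₂) (Λ : OLattice O F V) :
    ∃ (x : Module.Basis (Fin n₁) F W₁) (y : Module.Basis (Fin n₂) F W₂) (α : Part n₁),
      Λ = repLattice h ϖ x y α := by
  set N : Submodule O W₁ := Λ.1.comap (W₁.subtype.restrictScalars O) with hN
  have hNl : Submodule.IsLattice F N := isLattice_comap_subtype Λ.2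
  let p₂ := (W₂.projectionOnto W₁ h.symm).restrictScalars O
  set Q : Submodule O W₂ := Λ.1.map p₂ with hQ
  have hQl : Submodule.IsLattice F Q := isLattice_map_projectionOnto h.symm Λ.2
  obtain ⟨bN₀⟩ := exists_basis_of_isLattice e hNl
  obtain ⟨bQ₀⟩ := exists_basis_of_isLattice f hQl
  -- a section `s` of the projection `Λ → Q`, and its component `φ : Q → W₁`
  have hp₂ : ∀ v ∈ Λ.1, p₂ v ∈ Q := fun v hv => Submodule.mem_map_of_mem hv
  obtain ⟨s, hs⟩ := Module.projective_lifting_property (p₂.restrict hp₂) .id (by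
    rintro ⟨_, v, hv, rfl⟩
    exact ⟨⟨v, hv⟩, rfl⟩)
  have hs' : ∀ q, p₂ (s q) = q := fun q => congrArg Subtype.val (LinearMap.congr_fun hs q)
  let φ : Q →ₗ[O] W₁ := (W₁.projectionOnto W₂ h).restrictScalars O ∘ₗ Λ.1.subtype ∘ₗ s
  have hφ : ∀ q, (s q : V) = φ q + (q : W₂) := fun q => by
    have := Submodule.projection_add_projection_eq_self h (s q : V)
    rw [← this]
    congr 1
    rw [← hs' q]
    rfl
  -- Clearing denominators makes `ψ = d φ` land in the free module `N`, where Smith normal form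
  -- applies.
  obtain ⟨d, hd, hdφ⟩ := exists_smul_le_of_isLattice hNl (S := LinearMap.range φ)
    (Module.Finite.iff_fg.1 inferInstance)
  have hd0 : algebraMap O F d ≠ 0 := by
    simpa using (FaithfulSMul.algebraMap_injective O F).ne hd
  let ψ : Q →ₗ[O] N := (d • φ).codRestrict N fun q => hdφ _ ⟨q, rfl⟩
  have hψ : ∀ q, φ q = (algebraMap O F d)⁻¹ • (ψ q : W₁) := fun q => by
    change _ = (algebraMap O F d)⁻¹ • d • φ q
    rw [← algebraMap_smul F d, smul_smul, inv_mul_cancel₀ hd0, one_smul]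
  obtain ⟨bN, bQ, c, hc, hc0⟩ := exists_bases_smith bN₀ bQ₀ (Fin.castLEEmb hn) ψ
  choose a v o hco using fun i =>
    exists_eq_unit_mul_inv_pow_add (F := F) hϖ ((algebraMap O F d)⁻¹ * algebraMap O F (c i))
  have hφc : ∀ i, φ (bQ (Fin.castLEEmb hn i)) =
      (algebraMap O F ϖ)⁻¹ ^ a i • v i • (bN i : W₁) + o i • (bN i : W₁) := fun i => by
    rw [hψ, hc, Submodule.coe_smul_of_tower, ← algebraMap_smul F (c i), smul_smul, hco, add_smul,
      algebraMap_smul, mul_comm, mul_smul, algebraMap_smul, Units.smul_def]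
  -- sort the exponents
  let τ : Equiv.Perm (Fin n₁) := Tuple.sort (OrderDual.toDual ∘ a)
  have hτ : Antitone (a ∘ τ) := fun i j hij => Tuple.monotone_sort (OrderDual.toDual ∘ a) hij
  let σ : Equiv.Perm (Fin n₂) := τ.viaFintypeEmbedding (Fin.castLEEmb hn)
  let X := (bN.unitsSMul v).reindex τ.symm
  let Y := bQ.reindex σ.symm
  have hX : ∀ i, X i = v (τ i) • bN (τ i) := fun i => by simp [X, Module.Basis.unitsSMul_apply]
  have hY : ∀ i, φ (Y (Fin.castLEEmb hn i)) =
      (algebraMap O F ϖ)⁻¹ ^ a (τ i) • (X i : W₁) + (o (τ i) * ↑(v (τ i))⁻¹) • (X i : W₁) := by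
    intro i
    have h1 : Y (Fin.castLEEmb hn i) = bQ (Fin.castLEEmb hn (τ i)) := by
      simp only [Y, σ, Module.Basis.reindex_apply, Equiv.symm_symm,
        Equiv.Perm.viaFintypeEmbedding_apply_image]
    have h2 : (X i : W₁) = v (τ i) • (bN (τ i) : W₁) := by rw [hX]; rfl
    rw [h1, hφc, h2, Units.smul_def, smul_smul (o (τ i) * _), Units.inv_mul_cancel_right]
  have hY0 : ∀ j : Fin n₂, ¬ (j : ℕ) < n₁ → φ (Y j) = 0 := by
    intro j hj
    have hj' : j ∉ Set.range (Fin.castLEEmb hn) := by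
      rintro ⟨i, rfl⟩
      exact hj i.2
    have h1 : Y j = bQ j := by
      simp only [Y, σ, Module.Basis.reindex_apply, Equiv.symm_symm]
      rw [Equiv.Perm.viaFintypeEmbedding_apply_notMem_range _ _ hj']
    rw [h1, hψ, hc0 j hj']
    simp
  refine ⟨X.extendOfIsLattice F, Y.extendOfIsLattice F, ⟨a ∘ τ, hτ⟩, ?_⟩
  set S := repLattice h ϖ (X.extendOfIsLattice F) (Y.extendOfIsLattice F) ⟨a ∘ τ, hτ⟩ with hS
  have hSX : ∀ i, ((X i : W₁) : V) ∈ S.1 := fun i => by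
    have : repGen ϖ (X.extendOfIsLattice F) (Y.extendOfIsLattice F) ⟨a ∘ τ, hτ⟩ (.inl i) ∈ S.1 :=
      Submodule.subset_span ⟨_, rfl⟩
    simpa [repGen] using this
  -- the remaining generators of `Λ^α` agree with the vectors `s (Y j)` modulo `N`
  have hgen : ∀ j, ∃ w : N,
      repGen ϖ (X.extendOfIsLattice F) (Y.extendOfIsLattice F) ⟨a ∘ τ, hτ⟩ (.inr j) =
        s (Y j) - (w : W₁) := by
    intro j
    by_cases hj : (j : ℕ) < n₁
    · refine ⟨(o (τ ⟨j, hj⟩) * ↑(v (τ ⟨j, hj⟩))⁻¹) • X ⟨j, hj⟩, ?_⟩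
      have h1 := hY ⟨j, hj⟩
      have h2 : Fin.castLEEmb hn ⟨j, hj⟩ = j := rfl
      rw [h2] at h1
      rw [hφ, h1]
      simp only [repGen, dif_pos hj, Module.Basis.extendOfIsLattice_apply, Function.comp_apply]
      push_cast
      abel
    · refine ⟨0, ?_⟩
      rw [hφ, hY0 j hj]
      simp [repGen, dif_neg hj]
  have hNS : ∀ w : N, ((w : W₁) : V) ∈ S.1 := fun w => by
    rw [← X.sum_repr w]
    push_cast
    exact Submodule.sum_mem _ fun i _ => Submodule.smul_mem _ _ (hSX i)
  have hsS : ∀ q, (s q : V) ∈ S.1 := fun q => by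
    rw [← Y.sum_repr q, map_sum]
    push_cast
    refine Submodule.sum_mem _ fun j _ => ?_
    rw [map_smul]
    refine Submodule.smul_mem _ _ ?_
    obtain ⟨w, hw⟩ := hgen j
    rw [← sub_add_cancel (s (Y j) : V) ((w : W₁) : V), ← hw]
    exact Submodule.add_mem _ (Submodule.subset_span ⟨_, rfl⟩) (hNS w)
  refine Subtype.ext (le_antisymm (fun l hl => ?_) (Submodule.span_le.2 ?_))
  -- Any `l ∈ Λ` differs from the lift of its projection by an element of `N`.
  · have hker : l - s ⟨p₂ l, hp₂ l hl⟩ ∈ W₁ := by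
      rw [← Submodule.projectionOnto_apply_eq_zero_iff h.symm, map_sub, sub_eq_zero]
      exact (hs' ⟨p₂ l, hp₂ l hl⟩).symm
    have hmem : (⟨_, hker⟩ : W₁) ∈ N := Λ.1.sub_mem hl (s ⟨p₂ l, hp₂ l hl⟩).2
    rw [← sub_add_cancel l (s ⟨p₂ l, hp₂ l hl⟩ : V)]
    exact S.1.add_mem (hNS ⟨_, hmem⟩) (hsS _)
  · rintro _ ⟨i | j, rfl⟩
    · have : ((X i : W₁) : V) ∈ Λ.1 := (X i).2
      simpa [repGen] using this
    · obtain ⟨w, hw⟩ := hgen j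
      rw [hw]
      exact Λ.1.sub_mem (s (Y j)).2 w.2

lemma repOrbit_surjective (h : IsCompl W₁ W₂) {ϖ : O} (hϖ : Irreducible ϖ) (hn : n₁ ≤ n₂)
    (e : Module.Basis (Fin n₁) F W₁) (f : Module.Basis (Fin n₂) F W₂) :
    Function.Surjective (repOrbit (O := O) h ϖ e f) := by
  intro q
  induction q using Quotient.inductionOn with | h x =>
  induction x using Quotient.inductionOn with | h Λ =>
  obtain ⟨x, y, α, rfl⟩ := exists_eq_repLattice h hϖ hn e f Λ
  obtain ⟨g, hg, hgα⟩ := exists_levi_smul_repLattice h ϖ e x f y α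
  refine ⟨α, (Quotient.sound ?_).symm⟩
  exact ⟨⟨g, hg⟩, congrArg Vertex.mk hgα⟩

end Representatives

/-! ### Recovering `α` and bounding distances. -/

section Main

variable {O F V : Type*} [CommRing O] [IsDomain O] [IsDiscreteValuationRing O]
  [Field F] [Algebra O F] [IsFractionRing O F]
  [AddCommGroup V] [Module F V] [Module O V] [IsScalarTower O F V]
  {W₁ W₂ : Submodule F V} {n₁ n₂ : ℕ}

lemma isApprox_iff_of_mem_orbit (h : IsCompl W₁ W₂) {ϖ : O} (hϖ : Irreducible ϖ) (hn : n₁ ≤ n₂)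
    (e : Module.Basis (Fin n₁) F W₁) (f : Module.Basis (Fin n₂) F W₂) {x : Vertex O F V}
    {α : Part n₁} (hx : x ∈ MulAction.orbit (levi h) (Vertex.mk (repLattice h ϖ e f α)))
    (i : Fin n₁) (k : ℕ) : x.IsApprox h ϖ k i ↔ α.1 i ≤ k := by
  constructor
  · intro H
    exact le_of_isApprox_repLattice h hϖ e f hn α
      (Vertex.isApprox_mk.1 (H.of_orbit (MulAction.mem_orbit_symm.1 hx)))
  · intro hk
    refine Vertex.IsApprox.of_orbit (Vertex.isApprox_mk.2 ?_) hx
    refine isApprox_repLattice_of_le h ?_ e f α hk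
    simpa using (FaithfulSMul.algebraMap_injective O F).ne hϖ.ne_zero

/-- The distance between points of the orbits of `[Λ^α]` and `[Λ^β]` is at least the orbital
distance. -/
lemma orbitalDist_le_edist (h : IsCompl W₁ W₂) {ϖ : O} (hϖ : Irreducible ϖ) (hn : n₁ ≤ n₂)
    (e : Module.Basis (Fin n₁) F W₁) (f : Module.Basis (Fin n₂) F W₂) {x y : Vertex O F V}
    {α β : Part n₁} (hx : x ∈ MulAction.orbit (levi h) (Vertex.mk (repLattice h ϖ e f α)))
    (hy : y ∈ MulAction.orbit (levi h) (Vertex.mk (repLattice h ϖ e f β))) :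
    (orbitalDist α β : ℕ∞) ≤ (oneSkeleton F V ϖ).edist x y := by
  refine le_iInf fun p => Nat.cast_le.2 (Finset.sup_le fun i _ => ?_)
  -- The walk bounds `β_i - α_i` by its length, and its reverse bounds `α_i - β_i`.
  have h₁ := ((isApprox_iff_of_mem_orbit h hϖ hn e f hx i _).2 le_rfl).walk p
  have h₂ := ((isApprox_iff_of_mem_orbit h hϖ hn e f hy i _).2 le_rfl).walk p.reverse
  rw [isApprox_iff_of_mem_orbit h hϖ hn e f hy] at h₁
  rw [isApprox_iff_of_mem_orbit h hϖ hn e f hx, SimpleGraph.Walk.length_reverse] at h₂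
  omega

lemma repOrbit_injective (h : IsCompl W₁ W₂) {ϖ : O} (hϖ : Irreducible ϖ) (hn : n₁ ≤ n₂)
    (e : Module.Basis (Fin n₁) F W₁) (f : Module.Basis (Fin n₂) F W₂) :
    Function.Injective (repOrbit (O := O) h ϖ e f) := by
  intro α β hαβ
  have hmem : Vertex.mk (repLattice h ϖ e f α) ∈
    MulAction.orbit (levi h) (Vertex.mk (repLattice h ϖ e f β)) := Quotient.exact hαβ
  refine Subtype.ext (funext fun i => ?_)
  have h₁ := isApprox_iff_of_mem_orbit h hϖ hn e f (MulAction.mem_orbit_self _ :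
    Vertex.mk (repLattice h ϖ e f α) ∈ _) i
  have h₂ := isApprox_iff_of_mem_orbit h hϖ hn e f hmem i
  exact le_antisymm ((h₁ _).1 ((h₂ _).2 le_rfl)) ((h₂ _).1 ((h₁ _).2 le_rfl))

end Main

end LeviBuilding

theorem mainTheorem2 {O F V : Type*}
    [CommRing O] [IsDomain O] [IsDiscreteValuationRing O]
    [Field F] [Algebra O F] [IsFractionRing O F]
    [AddCommGroup V] [Module F V] [Module O V] [IsScalarTower O F V]
    (ϖ : O) (hϖ : Irreducible ϖ)
    {W₁ W₂ : Submodule F V} (hW : IsCompl W₁ W₂)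
    {n₁ n₂ : ℕ} (hn : n₁ ≤ n₂)
    (e : Module.Basis (Fin n₁) F W₁) (f : Module.Basis (Fin n₂) F W₂) :
    -- the `L`-orbits of vertices are identified with `A^{n₁}` by `α ↦ L[Λ^α]`
    Function.Bijective
      (LeviBuilding.repOrbit hW ϖ e f :
        LeviBuilding.Part n₁ →
          MulAction.orbitRel.Quotient (LeviBuilding.levi hW) (LeviBuilding.Vertex O F V)) ∧
    -- under this identification the orbital distance is the minimal distance between
    -- representatives of the two orbits
    ∀ (x₁ x₂ : LeviBuilding.Vertex O F V) (α β : LeviBuilding.Part n₁),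
      Quotient.mk _ x₁ = LeviBuilding.repOrbit hW ϖ e f α →
      Quotient.mk _ x₂ = LeviBuilding.repOrbit hW ϖ e f β →
      IsLeast
        {d : ℕ∞ | ∃ y₁ ∈ MulAction.orbit (LeviBuilding.levi hW) x₁,
          ∃ y₂ ∈ MulAction.orbit (LeviBuilding.levi hW) x₂,
            d = (LeviBuilding.oneSkeleton F V ϖ).edist y₁ y₂}
        (LeviBuilding.orbitalDist α β : ℕ∞) := by
  refine ⟨⟨LeviBuilding.repOrbit_injective hW hϖ hn e f,
    LeviBuilding.repOrbit_surjective hW hϖ hn e f⟩, fun x₁ x₂ α β h₁ h₂ => ?_⟩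
  have hx₁ : x₁ ∈ MulAction.orbit (LeviBuilding.levi hW)
    (LeviBuilding.Vertex.mk (LeviBuilding.repLattice hW ϖ e f α)) := Quotient.exact h₁
  have hx₂ : x₂ ∈ MulAction.orbit (LeviBuilding.levi hW)
    (LeviBuilding.Vertex.mk (LeviBuilding.repLattice hW ϖ e f β)) := Quotient.exact h₂
  rw [MulAction.orbit_eq_iff.2 hx₁, MulAction.orbit_eq_iff.2 hx₂]
  constructor
  · have hϖ0 : algebraMap O F ϖ ≠ 0 := by
      simpa using (FaithfulSMul.algebraMap_injective O F).ne hϖ.ne_zero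
    obtain ⟨g, hg, hle⟩ := LeviBuilding.exists_levi_edist_le (V := V) hW hϖ0 e f α β
    have hmem := MulAction.mem_orbit
      (LeviBuilding.Vertex.mk (LeviBuilding.repLattice hW ϖ e f β))
      (⟨g, hg⟩ : LeviBuilding.levi hW)
    exact ⟨_, MulAction.mem_orbit_self _, _, hmem, le_antisymm
      (LeviBuilding.orbitalDist_le_edist hW hϖ hn e f (MulAction.mem_orbit_self _) hmem) hle⟩
  · rintro _ ⟨y₁, hy₁, y₂, hy₂, rfl⟩
    exact LeviBuilding.orbitalDist_le_edist hW hϖ hn e f hy₁ hy₂
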